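/- Let $X$ be a uniformly convex real Banach space, that is, for every $\varepsilon\in(0,2]$ there is $\delta>0$ such that $\|x\|\le 1$, $\|y\|\le 1$ and $\|x-y\|>\varepsilon$ imply $\left\|\frac{x+y}{2}\right\|\le 1-\delta$. Suppose that $X$ has the Opial property: whenever a sequence $\{u_n\}$ in $X$ converges weakly to $x\in X$, then $$\limsup_{n\to\infty}\|u_n-x\|<\limsup_{n\to\infty}\|u_n-y\|\quad\text{for all } y\in X,\ y\ne x.$$ Let $C$ be a nonempty closed convex subset of $X$, and let $T:C\to C$ satisfy condition $(C)$: for all $x,y\in C$, $$\tfrac12\|x-Tx\|\le\|x-y\|\ \text{ implies }\ \|Tx-Ty\|\le\|x-y\|.$$ Suppose that the set $F(T)=\{p\in C: Tp=p\}$ is nonempty. Let $0<a\le b<1$, let $\{\alpha_n\}_{n\ge0}$ and $\{\beta_n\}_{n\ge0}$ be sequences of real numbers in $[a,b]$, let $x_0\in C$ be arbitrary, and let $\{x_n\}$ be the sequence of K iterates, defined for $n\ge 0$ by $$z_n=(1-\beta_n)x_n+\beta_nTx_n,\qquad y_n=T\big((1-\alpha_n)Tx_n+\alpha_nTz_n\big),\qquad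 x_{n+1}=Ty_n.$$ Then $\{x_n\}$ converges weakly to a fixed point of $T$, that is, to some $p\in F(T)$. -/

import Mathlib

open Filter Topology

/-- The sequence `u` converges to `x` in the weak topology of `X`. -/
def WeaklyConvergesTo {X : Type*} [NormedAddCommGroup X] [NormedSpace ℝ X]
    (u : ℕ → X) (x : X) : Prop :=
  Tendsto (fun n => toWeakSpace ℝ X (u n)) atTop (𝓝 (toWeakSpace ℝ X x))

/-- The Opial property. Weakly convergent sequences are norm bounded, so both upper limits
are upper limits of bounded sequences of real numbers. -/
def OpialProperty (X : Type*) [NormedAddCommGroup X] [NormedSpace ℝ X] : Prop :=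
  ∀ (u : ℕ → X) (x : X), WeaklyConvergesTo u x → ∀ y : X, y ≠ x →
    limsup (fun n => ‖u n - x‖) atTop < limsup (fun n => ‖u n - y‖) atTop

/-- Suzuki's condition (C) for a mapping on the set `C`. -/
def ConditionC {X : Type*} [NormedAddCommGroup X] (C : Set X) (T : X → X) : Prop :=
  ∀ x ∈ C, ∀ y ∈ C, (1 / 2 : ℝ) * ‖x - T x‖ ≤ ‖x - y‖ → ‖T x - T y‖ ≤ ‖x - y‖

/-- The set `F(T)` of fixed points of a mapping `T` of `C`. -/
def fixedPointsOn {X : Type*} (C : Set X) (T : X → X) : Set X :=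
  {p | p ∈ C ∧ T p = p}

/-- One step of the K iteration with parameters `a = αₙ` and `b = βₙ`:
`z = (1 - b) x + b T x`, `y = T ((1 - a) T x + a T z)`, and the next iterate is `T y`. -/
def kStep {X : Type*} [NormedAddCommGroup X] [NormedSpace ℝ X]
    (T : X → X) (a b : ℝ) (x : X) : X :=
  let z := (1 - b) • x + b • T x
  let y := T ((1 - a) • T x + a • T z)
  T y

/-- The K iterates of `T` with parameter sequences `α`, `β`, started at `x₀`. -/
def kIterate {X : Type*} [NormedAddCommGroup X] [NormedSpace ℝ X]
    (T : X → X) (α β : ℕ → ℝ) (x₀ : X) : ℕ → X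
  | 0 => x₀
  | n + 1 => kStep T (α n) (β n) (kIterate T α β x₀ n)

/-! Condition (C) makes `T` quasi-nonexpansive, so the iterates never move away from a fixed point
`p` and their distances to `p` converge. While `‖x - T x‖ ≥ ε`, uniform convexity puts `z`, hence
the next iterate, closer to `p` by a fixed amount; so `‖xₙ - T xₙ‖ → 0`. The iterates are bounded,
so they have weakly convergent subsequences, and the Opial property with `‖x - T y‖ ≤ ‖x - y‖ + 3 ‖x
- T x‖` makes every weak limit a fixed point. Opial again forbids two different limits, so the whole
sequence converges weakly. -/

open Set Metric

/-! ### Uniform convexity and weak limits along ultrafilters -/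

section UniformConvexity

variable {X : Type*} [NormedAddCommGroup X] [NormedSpace ℝ X] [UniformConvexSpace X]

/-- Uniform convexity, uniformly over all balls of radius at most `M`. -/
theorem exists_forall_norm_add_le_two_sub_mul {ε M : ℝ} (hε : 0 < ε) (hM : 0 < M) :
    ∃ δ, 0 < δ ∧ ∀ r ≤ M, ∀ x y : X, ‖x‖ ≤ r → ‖y‖ ≤ r → ε ≤ ‖x - y‖ →
      ‖x + y‖ ≤ (2 - δ) * r := by
  obtain ⟨δ, hδ, h⟩ := exists_forall_closed_ball_dist_add_le_two_sub X (div_pos hε hM)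
  refine ⟨δ, hδ, fun r hrM x y hx hy hxy => ?_⟩
  have hr : 0 < r := by
    have := norm_sub_le x y
    linarith
  have key (v : X) : ‖r⁻¹ • v‖ = ‖v‖ / r := by
    rw [norm_smul_of_nonneg (inv_nonneg.2 hr.le), div_eq_inv_mul]
  have := @h (r⁻¹ • x) (by rw [key]; exact (div_le_one hr).2 hx)
    (r⁻¹ • y) (by rw [key]; exact (div_le_one hr).2 hy)
    (by rw [← smul_sub, key]; gcongr)
  rwa [← smul_add, key, div_le_iff₀ hr] at this

/-- A convex combination of two points of a ball that are far apart lies well inside the ball. -/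
theorem exists_forall_norm_combo_le {ε M m : ℝ} (hε : 0 < ε) (hM : 0 < M) (hm : 0 < m) :
    ∃ η, 0 < η ∧ ∀ r ≤ M, ∀ x y : X, ‖x‖ ≤ r → ‖y‖ ≤ r → ε ≤ ‖x - y‖ →
      ∀ t, m ≤ t → t ≤ 1 - m → ‖(1 - t) • x + t • y‖ ≤ r - η := by
  obtain ⟨δ, hδ, h⟩ := exists_forall_norm_add_le_two_sub_mul (X := X) hε hM
  refine ⟨m * δ * (ε / 2), by positivity, fun r hrM x y hx hy hxy t hmt htm => ?_⟩
  have hsum := h r hrM x y hx hy hxy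
  have hr : ε / 2 ≤ r := by
    have := norm_sub_le x y
    linarith
  have hgain : m * δ * (ε / 2) ≤ m * δ * r := by gcongr
  have hmono (c : ℝ) (hc : m ≤ c) : m * δ * r ≤ c * δ * r := by
    have : 0 ≤ r := by linarith
    gcongr
  -- Split off `min t (1 - t) ≥ m` times `x + y`, which carries the gain `δ`; the remaining weight
  -- falls on one endpoint.
  rcases le_total t (1 / 2) with ht | ht
  · have e : (1 - t) • x + t • y = (1 - 2 * t) • x + t • (x + y) := by module
    have h1 : ‖(1 - 2 * t) • x‖ ≤ (1 - 2 * t) * r := by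
      rw [norm_smul_of_nonneg (by linarith)]
      exact mul_le_mul_of_nonneg_left hx (by linarith)
    have h2 : ‖t • (x + y)‖ ≤ t * ((2 - δ) * r) := by
      rw [norm_smul_of_nonneg (by linarith)]
      exact mul_le_mul_of_nonneg_left hsum (by linarith)
    rw [e]
    linarith [norm_add_le ((1 - 2 * t) • x) (t • (x + y)), hmono t hmt]
  · have e : (1 - t) • x + t • y = (2 * t - 1) • y + (1 - t) • (x + y) := by module
    have h1 : ‖(2 * t - 1) • y‖ ≤ (2 * t - 1) * r := by
      rw [norm_smul_of_nonneg (by linarith)]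
      exact mul_le_mul_of_nonneg_left hy (by linarith)
    have h2 : ‖(1 - t) • (x + y)‖ ≤ (1 - t) * ((2 - δ) * r) := by
      rw [norm_smul_of_nonneg (by linarith)]
      exact mul_le_mul_of_nonneg_left hsum (by linarith)
    rw [e]
    linarith [norm_add_le ((2 * t - 1) • y) ((1 - t) • (x + y)), hmono (1 - t) (by linarith)]

variable [CompleteSpace X]

/-- In a uniformly convex Banach space, the closed convex sets belonging to a filter that
contains a bounded set and is proper have a common point. -/
theorem exists_mem_forall_isClosed_convex (U : Filter X) [U.NeBot] {R : ℝ}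
    (hR : closedBall (0 : X) R ∈ U) :
    ∃ x : X, ∀ K ∈ U, IsClosed K → Convex ℝ K → x ∈ K := by
  -- As for a point of least norm in a convex set: with `s = sInf S`, the points of norm about `s`
  -- in a small enough `K` are close together.
  let S : Set ℝ := {r | ∀ K ∈ U, IsClosed K → Convex ℝ K → (K ∩ closedBall (0 : X) r).Nonempty}
  have hRS : R ∈ S := fun K hK _ _ => Filter.nonempty_of_mem (inter_mem hK hR)
  have hS0 : ∀ r ∈ S, 0 ≤ r := fun r hr => by
    obtain ⟨x, -, hx⟩ := hr univ univ_mem isClosed_univ convex_univ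
    exact (norm_nonneg x).trans (mem_closedBall_zero_iff.1 hx)
  have hbdd : BddBelow S := ⟨0, hS0⟩
  obtain ⟨s, hs⟩ : ∃ s, s = sInf S := ⟨_, rfl⟩
  have hs0 : 0 ≤ s := hs ▸ le_csInf ⟨R, hRS⟩ hS0
  have hne : ∀ ε > 0, ∀ K ∈ U, IsClosed K → Convex ℝ K →
      (K ∩ closedBall (0 : X) (s + ε)).Nonempty := fun ε hε K hK h1 h2 => by
    obtain ⟨r, hrS, hr⟩ := exists_lt_of_csInf_lt ⟨R, hRS⟩
      (hs.symm.trans_lt (lt_add_of_pos_right s hε))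
    exact (hrS K hK h1 h2).mono (inter_subset_inter_right _ (closedBall_subset_closedBall hr.le))
  have hfar : ∀ ε > 0, ∃ K ∈ U, IsClosed K ∧ Convex ℝ K ∧ ∀ x ∈ K, s - ε < ‖x‖ := fun ε hε => by
    have : s - ε ∉ S := fun h => by linarith [hs ▸ csInf_le hbdd h]
    simp only [S, mem_ofPred_eq, not_forall] at this
    obtain ⟨K, hK, h1, h2, h3⟩ := this
    refine ⟨K, hK, h1, h2, fun x hx => ?_⟩
    by_contra! hle
    exact h3 ⟨x, hx, mem_closedBall_zero_iff.2 hle⟩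
  let I := {K : Set X // K ∈ U ∧ IsClosed K ∧ Convex ℝ K} × {ε : ℝ // 0 < ε}
  let A : I → Set X := fun i => i.1.1 ∩ closedBall 0 (s + i.2.1)
  have : Nonempty I :=
    ⟨⟨⟨univ, univ_mem, isClosed_univ, convex_univ⟩, ⟨1, one_pos⟩⟩⟩
  have hdir : Directed (· ≥ ·) fun i : I => 𝓟 (A i) := by
    rintro ⟨⟨K, hK, hKc, hKv⟩, ⟨ε, hε⟩⟩ ⟨⟨L, hL, hLc, hLv⟩, ⟨η, hη⟩⟩
    refine ⟨⟨⟨K ∩ L, inter_mem hK hL, hKc.inter hLc, hKv.inter hLv⟩,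
      ⟨min ε η, lt_min hε hη⟩⟩, ?_, ?_⟩
    · refine principal_mono.2 (inter_subset_inter inter_subset_left (closedBall_subset_closedBall ?_))
      simp
    · refine principal_mono.2 (inter_subset_inter inter_subset_right
        (closedBall_subset_closedBall ?_))
      simp
  have hneBot : (⨅ i : I, 𝓟 (A i)).NeBot := iInf_neBot_of_directed' hdir fun i =>
    principal_neBot_iff.2 (hne _ i.2.2 _ i.1.2.1 i.1.2.2.1 i.1.2.2.2)
  have hcauchy : Cauchy (⨅ i : I, 𝓟 (A i)) := by
    refine Metric.cauchy_iff.2 ⟨hneBot, fun ε hε => ?_⟩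
    obtain ⟨η, hη, h⟩ := exists_forall_norm_combo_le (X := X) (M := s + 1) (m := 1 / 2)
      hε (by linarith) (by norm_num)
    -- Two far points of norm at most `s + η / 2` have a midpoint of norm at most `s - η / 2`, which
    -- this `K` excludes.
    obtain ⟨K, hK, hKc, hKv, hKs⟩ := hfar (η / 2) (by linarith)
    have hpos : 0 < min 1 (η / 2) := lt_min one_pos (by linarith)
    let i : I := ⟨⟨K, hK, hKc, hKv⟩, ⟨min 1 (η / 2), hpos⟩⟩
    refine ⟨A i, mem_iInf_of_mem i (mem_principal_self _), fun x hx y hy => ?_⟩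
    by_contra! hxy
    have hmid : (1 - (1 / 2 : ℝ)) • x + (1 / 2 : ℝ) • y ∈ K :=
      hKv hx.1 hy.1 (by norm_num) (by norm_num) (by norm_num)
    have h1 := h (s + min 1 (η / 2)) (by gcongr; exact min_le_left _ _) x y
      (mem_closedBall_zero_iff.1 hx.2) (mem_closedBall_zero_iff.1 hy.2)
      (by rwa [← dist_eq_norm]) (1 / 2) le_rfl (by norm_num)
    linarith [hKs _ hmid, min_le_right 1 (η / 2)]
  obtain ⟨x, hx⟩ := CompleteSpace.complete hcauchy
  refine ⟨x, fun K hK hKc hKv => ?_⟩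
  have hKF : K ∈ ⨅ i : I, 𝓟 (A i) :=
    mem_iInf_of_mem (⟨⟨K, hK, hKc, hKv⟩, ⟨1, one_pos⟩⟩ : I) (mem_principal.2 inter_subset_left)
  exact isClosed_iff_clusterPt.1 hKc x ((ClusterPt.of_le_nhds hx).mono (le_principal_iff.2 hKF))

/-- In a uniformly convex Banach space, every bounded ultrafilter has a weak limit, which lies in
all the closed convex members of the ultrafilter. -/
theorem Ultrafilter.exists_weak_limit (U : Ultrafilter X) {R : ℝ}
    (hR : closedBall (0 : X) R ∈ U) :
    ∃ x : X, (∀ f : StrongDual ℝ X, Tendsto f U (𝓝 (f x))) ∧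
      ∀ K ∈ U, IsClosed K → Convex ℝ K → x ∈ K := by
  obtain ⟨x, hx⟩ := exists_mem_forall_isClosed_convex (U : Filter X) hR
  refine ⟨x, fun f => ?_, hx⟩
  have hball : closedBall (0 : ℝ) (‖f‖ * R) ∈ (U.map f : Ultrafilter ℝ) := by
    rw [Ultrafilter.mem_map]
    refine mem_of_superset hR fun y hy => ?_
    rw [mem_preimage, mem_closedBall_zero_iff]
    exact (f.le_opNorm y).trans (by gcongr; exact mem_closedBall_zero_iff.1 hy)
  obtain ⟨l, -, hl⟩ := isCompact_iff_ultrafilter_le_nhds'.1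
    (isCompact_closedBall (0 : ℝ) (‖f‖ * R)) _ hball
  have hl' : Tendsto f U (𝓝 l) := hl
  have hfx : f x = l := by
    refine eq_of_forall_dist_le fun ε hε => ?_
    exact hx (f ⁻¹' closedBall l ε) (hl' (closedBall_mem_nhds l hε))
      (isClosed_closedBall.preimage f.continuous)
      ((convex_closedBall l ε).is_linear_preimage f.toLinearMap.isLinear)
  rwa [hfx]

end UniformConvexity

/-! ### Weak sequential compactness -/

section WeakConvergence

variable {X : Type*} [NormedAddCommGroup X] [NormedSpace ℝ X]

theorem weaklyConvergesTo_iff {u : ℕ → X} {x : X} :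
    WeaklyConvergesTo u x ↔ ∀ f : StrongDual ℝ X, Tendsto (fun n => f (u n)) atTop (𝓝 (f x)) := by
  have hind : IsInducing fun (y : WeakSpace ℝ X) (f : StrongDual ℝ X) =>
      (topDualPairing ℝ X).flip y f := ⟨rfl⟩
  exact hind.tendsto_nhds_iff.trans tendsto_pi_nhds

theorem WeaklyConvergesTo.mem_of_isClosed_convex {u : ℕ → X} {x : X} (h : WeaklyConvergesTo u x)
    {C : Set X} (hC : IsClosed C) (hCv : Convex ℝ C) (hu : ∀ n, u n ∈ C) : x ∈ C := by
  by_contra hx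
  obtain ⟨f, c, hfC, hfx⟩ := geometric_hahn_banach_closed_point hCv hC hx
  exact (le_of_tendsto' (weaklyConvergesTo_iff.1 h f) fun n => (hfC _ (hu n)).le).not_gt hfx

/-- A separable set has a countable family of functionals such that two points of the set that
are not distinguished by the family are equal. -/
theorem exists_countable_separating_dual {Y : Submodule ℝ X}
    (hY : TopologicalSpace.IsSeparable (Y : Set X)) :
    ∃ c : Set X, c.Countable ∧ ∃ f : c → StrongDual ℝ X,
      ∀ x ∈ Y, ∀ y ∈ Y, (∀ i, f i x = f i y) → x = y := by
  obtain ⟨c, hc, hYc⟩ := hY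
  choose f hf1 hf using fun i : c => exists_dual_vector'' ℝ (i : X)
  refine ⟨c, hc, f, fun x hx y hy hxy => ?_⟩
  refine sub_eq_zero.1 (norm_le_zero_iff.1 (le_of_forall_pos_le_add fun ε hε => ?_))
  obtain ⟨d, hd, hdist⟩ := Metric.mem_closure_iff.1 (hYc (Y.sub_mem hx hy)) (ε / 2) (half_pos hε)
  rw [dist_eq_norm] at hdist
  have h1 : ‖d‖ ≤ ‖x - y - d‖ := by
    have e : f ⟨d, hd⟩ (d - (x - y)) = ‖d‖ := by
      rw [map_sub, map_sub, hxy, sub_self, sub_zero]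
      exact hf ⟨d, hd⟩
    calc ‖d‖ = f ⟨d, hd⟩ (d - (x - y)) := e.symm
      _ ≤ ‖f ⟨d, hd⟩ (d - (x - y))‖ := le_abs_self _
      _ ≤ 1 * ‖d - (x - y)‖ := (f ⟨d, hd⟩).le_of_opNorm_le (hf1 _) _
      _ = ‖x - y - d‖ := by rw [one_mul, norm_sub_rev]
  have h2 : ‖x - y‖ ≤ ‖x - y - d‖ + ‖d‖ := by
    simpa using norm_add_le (x - y - d) d
  linarith

/-- Bounded sequences in a uniformly convex Banach space have weakly convergent subsequences. -/
theorem exists_weaklyConvergesTo_subseq [UniformConvexSpace X] [CompleteSpace X]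
    {u : ℕ → X} {R : ℝ} (hu : ∀ n, ‖u n‖ ≤ R) :
    ∃ (x : X) (φ : ℕ → ℕ), StrictMono φ ∧ WeaklyConvergesTo (u ∘ φ) x := by
  let Y : Submodule ℝ X := (Submodule.span ℝ (range u)).topologicalClosure
  have huY (n : ℕ) : u n ∈ Y :=
    Submodule.le_topologicalClosure _ (Submodule.subset_span (mem_range_self n))
  have hYc : IsClosed (Y : Set X) := Submodule.isClosed_topologicalClosure _
  have hY : TopologicalSpace.IsSeparable (Y : Set X) := by
    rw [Submodule.topologicalClosure_coe]
    exact ((countable_range u).isSeparable.span (R := ℝ)).closure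
  obtain ⟨c, hc, f, hf⟩ := exists_countable_separating_dual hY
  have : Countable c := hc.to_subtype
  obtain ⟨l, -, φ, hφ, hl⟩ := (isCompact_univ_pi fun i : c =>
    isCompact_closedBall (0 : ℝ) (‖f i‖ * R)).tendsto_subseq (x := fun n i => f i (u n))
    (fun n i _ => mem_closedBall_zero_iff.2 ((f i).le_opNorm_of_le (hu n)))
  -- Every ultrafilter limit of the subsequence lies in `Y` with coordinates `l`, so all these
  -- limits coincide.
  have hlim (g : Ultrafilter ℕ) (hg : (g : Filter ℕ) ≤ atTop) :
      ∃ x ∈ Y, (∀ h : StrongDual ℝ X, Tendsto (fun n => h (u (φ n))) g (𝓝 (h x))) ∧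
        ∀ i, f i x = l i := by
    obtain ⟨x, hx, hxK⟩ := (g.map (u ∘ φ)).exists_weak_limit (R := R)
      (Ultrafilter.mem_map.2 (univ_mem' fun n => mem_closedBall_zero_iff.2 (hu (φ n))))
    have hx' (h : StrongDual ℝ X) : Tendsto (fun n => h (u (φ n))) g (𝓝 (h x)) := hx h
    exact ⟨x, hxK Y (Ultrafilter.mem_map.2 (univ_mem' fun n => huY (φ n))) hYc Y.convex, hx',
      fun i => tendsto_nhds_unique (hx' (f i)) ((tendsto_pi_nhds.1 hl i).mono_left hg)⟩
  obtain ⟨x, hxY, -, hxl⟩ := hlim (Ultrafilter.of atTop) (Ultrafilter.of_le atTop)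
  refine ⟨x, φ, hφ, weaklyConvergesTo_iff.2 fun h => ?_⟩
  refine (tendsto_iff_ultrafilter _ _ _).2 fun g hg => ?_
  obtain ⟨y, hyY, hy, hyl⟩ := hlim g hg
  rw [hf x hxY y hyY fun i => (hxl i).trans (hyl i).symm]
  exact hy h

end WeakConvergence

section ConditionC

variable {X : Type*} [NormedAddCommGroup X] {C : Set X} {T : X → X}

theorem ConditionC.norm_sub_fixed_le (hT : ConditionC C T) {p x : X} (hp : p ∈ fixedPointsOn C T)
    (hx : x ∈ C) : ‖T x - p‖ ≤ ‖x - p‖ := by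
  have := hT p hp.1 x hx (by simp [hp.2])
  rwa [hp.2, norm_sub_rev, norm_sub_rev p x] at this

/-- Condition (C) always applies to `x, T x`. If it fails to apply to `x, y`, then `y` is so near
`x` that it applies to `T x, y`. -/
theorem ConditionC.norm_sub_map_le (hT : ConditionC C T) (hTC : MapsTo T C C) {x y : X}
    (hx : x ∈ C) (hy : y ∈ C) : ‖x - T y‖ ≤ ‖x - y‖ + 3 * ‖x - T x‖ := by
  have h2 : ‖T x - T (T x)‖ ≤ ‖x - T x‖ :=
    hT x hx (T x) (hTC hx) (by linarith [norm_nonneg (x - T x)])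
  have t1 := norm_sub_le_norm_sub_add_norm_sub x (T x) (T y)
  by_cases h : (1 / 2 : ℝ) * ‖x - T x‖ ≤ ‖x - y‖
  · linarith [hT x hx y hy h, norm_nonneg (x - T x)]
  · have t2 := norm_sub_le_norm_sub_add_norm_sub x y (T x)
    have t3 := norm_sub_le_norm_sub_add_norm_sub (T x) (T (T x)) (T y)
    have t4 := norm_sub_le_norm_sub_add_norm_sub (T x) x y
    rw [norm_sub_rev y (T x)] at t2
    rw [norm_sub_rev (T x) x] at t4
    linarith [hT (T x) (hTC hx) y hy (by linarith)]

end ConditionC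

/-! ### Consequences of the Opial property -/

section Opial

variable {X : Type*} [NormedAddCommGroup X] [NormedSpace ℝ X] {C : Set X} {T : X → X}

theorem limsup_le_limsup_of_le_add {v w e : ℕ → ℝ} (hv : ∀ n, 0 ≤ v n) {M : ℝ}
    (hw : ∀ n, w n ≤ M) (h : ∀ n, v n ≤ w n + e n) (he : Tendsto e atTop (𝓝 0)) :
    limsup v atTop ≤ limsup w atTop := by
  refine le_of_forall_pos_le_add fun ε hε => ?_
  have h1 : ∀ᶠ n in atTop, w n < limsup w atTop + ε / 2 :=
    eventually_lt_of_limsup_lt (by linarith) (isBoundedUnder_of ⟨M, hw⟩)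
  have h2 : ∀ᶠ n in atTop, e n < ε / 2 := he.eventually_lt_const (by linarith)
  refine limsup_le_of_le (isCoboundedUnder_le_of_le atTop hv) ?_
  filter_upwards [h1, h2] with n h1 h2
  linarith [h n]

/-- Demiclosedness of `1 - T` at zero, for bounded sequences. -/
theorem ConditionC.map_eq_of_weaklyConvergesTo (hX : OpialProperty X) (hT : ConditionC C T)
    (hTC : MapsTo T C C) {u : ℕ → X} {x : X} (hu : ∀ n, u n ∈ C) (hx : x ∈ C)
    (hux : WeaklyConvergesTo u x) {R : ℝ} (hR : ∀ n, ‖u n‖ ≤ R)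
    (hreg : Tendsto (fun n => ‖u n - T (u n)‖) atTop (𝓝 0)) : T x = x := by
  by_contra hne
  refine (hX u x hux (T x) hne).not_ge ?_
  refine limsup_le_limsup_of_le_add (M := R + ‖x‖) (e := fun n => 3 * ‖u n - T (u n)‖)
    (fun n => norm_nonneg _) (fun n => (norm_sub_le _ _).trans (by gcongr; exact hR n))
    (fun n => hT.norm_sub_map_le hTC (hu n) hx) ?_
  simpa using hreg.const_mul 3

/-- If the distances of a sequence to two points converge, then subsequences cannot converge
weakly to both unless the points agree. -/
theorem OpialProperty.eq_of_tendsto_norm_sub (hX : OpialProperty X) {u : ℕ → X} {p q : X}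
    {c d : ℝ} (hc : Tendsto (fun n => ‖u n - p‖) atTop (𝓝 c))
    (hd : Tendsto (fun n => ‖u n - q‖) atTop (𝓝 d)) {φ ψ : ℕ → ℕ} (hφ : Tendsto φ atTop atTop)
    (hψ : Tendsto ψ atTop atTop) (hp : WeaklyConvergesTo (u ∘ φ) p)
    (hq : WeaklyConvergesTo (u ∘ ψ) q) : p = q := by
  by_contra hne
  have h1 := hX _ _ hp q (Ne.symm hne)
  have h2 := hX _ _ hq p hne
  have e1 : limsup (fun n => ‖(u ∘ φ) n - p‖) atTop = c := (hc.comp hφ).limsup_eq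
  have e2 : limsup (fun n => ‖(u ∘ φ) n - q‖) atTop = d := (hd.comp hφ).limsup_eq
  have e3 : limsup (fun n => ‖(u ∘ ψ) n - p‖) atTop = c := (hc.comp hψ).limsup_eq
  have e4 : limsup (fun n => ‖(u ∘ ψ) n - q‖) atTop = d := (hd.comp hψ).limsup_eq
  rw [e1, e2] at h1
  rw [e3, e4] at h2
  exact h1.not_gt h2

end Opial

/-! ### Monotonicity and asymptotic regularity of the K iteration -/

section KIteration

variable {X : Type*} [NormedAddCommGroup X] [NormedSpace ℝ X] {C : Set X} {T : X → X}

theorem kStep_mem (hC : Convex ℝ C) (hTC : MapsTo T C C) {s t : ℝ} (hs : s ∈ Icc (0 : ℝ) 1)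
    (ht : t ∈ Icc (0 : ℝ) 1) {x : X} (hx : x ∈ C) : kStep T s t x ∈ C := by
  have hcombo {r : ℝ} (hr : r ∈ Icc (0 : ℝ) 1) {v w : X} (hv : v ∈ C) (hw : w ∈ C) :
      (1 - r) • v + r • w ∈ C := hC hv hw (by linarith [hr.2]) hr.1 (by ring)
  exact hTC (hTC (hcombo hs (hTC hx) (hTC (hcombo ht hx (hTC hx)))))

theorem norm_combo_sub_le {r : ℝ} (hr : r ∈ Icc (0 : ℝ) 1) (v w p : X) :
    ‖(1 - r) • v + r • w - p‖ ≤ (1 - r) * ‖v - p‖ + r * ‖w - p‖ := by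
  have e : (1 - r) • v + r • w - p = (1 - r) • (v - p) + r • (w - p) := by module
  rw [e, ← norm_smul_of_nonneg (by linarith [hr.2]) (v - p), ← norm_smul_of_nonneg hr.1 (w - p)]
  exact norm_add_le _ _

/-- Keeping the distance from `z` to `p` explicit lets a gain at `z` survive with weight `s`. -/
theorem ConditionC.norm_kStep_sub_le (hT : ConditionC C T) (hC : Convex ℝ C) (hTC : MapsTo T C C)
    {p : X} (hp : p ∈ fixedPointsOn C T) {s t : ℝ} (hs : s ∈ Icc (0 : ℝ) 1)
    (ht : t ∈ Icc (0 : ℝ) 1) {x : X} (hx : x ∈ C) :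
    ‖kStep T s t x - p‖ ≤ (1 - s) * ‖x - p‖ + s * ‖(1 - t) • x + t • T x - p‖ := by
  have hcombo {r : ℝ} (hr : r ∈ Icc (0 : ℝ) 1) {v w : X} (hv : v ∈ C) (hw : w ∈ C) :
      (1 - r) • v + r • w ∈ C := hC hv hw (by linarith [hr.2]) hr.1 (by ring)
  have hz := hcombo ht hx (hTC hx)
  have hw := hcombo hs (hTC hx) (hTC hz)
  calc ‖kStep T s t x - p‖
      ≤ ‖(1 - s) • T x + s • T ((1 - t) • x + t • T x) - p‖ :=
        (hT.norm_sub_fixed_le hp (hTC hw)).trans (hT.norm_sub_fixed_le hp hw)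
    _ ≤ (1 - s) * ‖T x - p‖ + s * ‖T ((1 - t) • x + t • T x) - p‖ := norm_combo_sub_le hs _ _ _
    _ ≤ _ := add_le_add
        (mul_le_mul_of_nonneg_left (hT.norm_sub_fixed_le hp hx) (by linarith [hs.2]))
        (mul_le_mul_of_nonneg_left (hT.norm_sub_fixed_le hp hz) hs.1)

theorem ConditionC.norm_kStep_sub_le_norm_sub (hT : ConditionC C T) (hC : Convex ℝ C)
    (hTC : MapsTo T C C) {p : X} (hp : p ∈ fixedPointsOn C T) {s t : ℝ} (hs : s ∈ Icc (0 : ℝ) 1)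
    (ht : t ∈ Icc (0 : ℝ) 1) {x : X} (hx : x ∈ C) : ‖kStep T s t x - p‖ ≤ ‖x - p‖ := by
  have h1 := hT.norm_kStep_sub_le hC hTC hp hs ht hx
  have h2 := norm_combo_sub_le ht x (T x) p
  have h3 := mul_le_mul_of_nonneg_left (hT.norm_sub_fixed_le hp hx) ht.1
  have h4 : s * ‖(1 - t) • x + t • T x - p‖ ≤ s * ‖x - p‖ :=
    mul_le_mul_of_nonneg_left (by linarith) hs.1
  linarith

/-- A K step from a point which `T` moves by at least `ε` comes closer to the fixed points by a
definite amount. -/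
theorem ConditionC.exists_norm_kStep_sub_le_sub [UniformConvexSpace X] (hT : ConditionC C T)
    (hC : Convex ℝ C) (hTC : MapsTo T C C) {p : X} (hp : p ∈ fixedPointsOn C T)
    {a b : ℝ} (ha : 0 < a) (hb : b < 1) {ε : ℝ} (hε : 0 < ε) (M : ℝ) :
    ∃ η > 0, ∀ s ∈ Icc a b, ∀ t ∈ Icc a b, ∀ x ∈ C, ‖x - p‖ ≤ M → ε ≤ ‖x - T x‖ →
      ‖kStep T s t x - p‖ ≤ ‖x - p‖ - η := by
  obtain ⟨η, hη, h⟩ := exists_forall_norm_combo_le (X := X) (M := max M 1) (m := min a (1 - b))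
    hε (by positivity) (lt_min ha (by linarith))
  refine ⟨a * η, mul_pos ha hη, fun s hs t ht x hx hxM hxε => ?_⟩
  have hs' : s ∈ Icc (0 : ℝ) 1 := ⟨by linarith [hs.1], by linarith [hs.2]⟩
  have ht' : t ∈ Icc (0 : ℝ) 1 := ⟨by linarith [ht.1], by linarith [ht.2]⟩
  have h1 := hT.norm_kStep_sub_le hC hTC hp hs' ht' hx
  have h2 := h ‖x - p‖ (hxM.trans (le_max_left _ _)) (x - p) (T x - p) le_rfl
    (hT.norm_sub_fixed_le hp hx) (by rwa [sub_sub_sub_cancel_right]) t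
    ((min_le_left _ _).trans ht.1) (by linarith [ht.2, min_le_right a (1 - b)])
  have e : (1 - t) • x + t • T x - p = (1 - t) • (x - p) + t • (T x - p) := by module
  rw [← e] at h2
  have h3 := mul_le_mul_of_nonneg_left h2 hs'.1
  have h4 := mul_le_mul_of_nonneg_right hs.1 hη.le
  linarith

variable {α β : ℕ → ℝ} {x₀ : X}

theorem kIterate_mem (hC : Convex ℝ C) (hTC : MapsTo T C C) (hα : ∀ n, α n ∈ Icc (0 : ℝ) 1)
    (hβ : ∀ n, β n ∈ Icc (0 : ℝ) 1) (hx₀ : x₀ ∈ C) (n : ℕ) : kIterate T α β x₀ n ∈ C := by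
  induction n with
  | zero => exact hx₀
  | succ n ih => exact kStep_mem hC hTC (hα n) (hβ n) ih

theorem ConditionC.antitone_norm_kIterate_sub (hT : ConditionC C T) (hC : Convex ℝ C)
    (hTC : MapsTo T C C) {p : X} (hp : p ∈ fixedPointsOn C T) (hα : ∀ n, α n ∈ Icc (0 : ℝ) 1)
    (hβ : ∀ n, β n ∈ Icc (0 : ℝ) 1) (hx₀ : x₀ ∈ C) :
    Antitone fun n => ‖kIterate T α β x₀ n - p‖ :=
  antitone_nat_of_succ_le fun n =>
    hT.norm_kStep_sub_le_norm_sub hC hTC hp (hα n) (hβ n) (kIterate_mem hC hTC hα hβ hx₀ n)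

theorem Antitone.exists_tendsto_of_nonneg {r : ℕ → ℝ} (hr : Antitone r) (h0 : ∀ n, 0 ≤ r n) :
    ∃ c, Tendsto r atTop (𝓝 c) :=
  ⟨_, tendsto_atTop_ciInf hr ⟨0, forall_mem_range.2 h0⟩⟩

/-- The K iterates are asymptotically regular. -/
theorem ConditionC.tendsto_norm_kIterate_sub_map [UniformConvexSpace X] (hT : ConditionC C T)
    (hC : Convex ℝ C) (hTC : MapsTo T C C) (hF : (fixedPointsOn C T).Nonempty)
    {a b : ℝ} (ha : 0 < a) (hb : b < 1) (hα : ∀ n, α n ∈ Icc a b) (hβ : ∀ n, β n ∈ Icc a b)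
    (hx₀ : x₀ ∈ C) :
    Tendsto (fun n => ‖kIterate T α β x₀ n - T (kIterate T α β x₀ n)‖) atTop (𝓝 0) := by
  obtain ⟨p, hp⟩ := hF
  have hsub : Icc a b ⊆ Icc 0 1 := Icc_subset_Icc ha.le hb.le
  have hanti := hT.antitone_norm_kIterate_sub hC hTC hp (fun n => hsub (hα n))
    (fun n => hsub (hβ n)) hx₀
  obtain ⟨c, hc⟩ := hanti.exists_tendsto_of_nonneg fun n => norm_nonneg _
  have hdiff := hc.sub (hc.comp (tendsto_add_atTop_nat 1))
  rw [sub_self] at hdiff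
  refine (nhds_basis_ball.tendsto_right_iff).2 fun ε hε => ?_
  obtain ⟨η, hη, h⟩ := hT.exists_norm_kStep_sub_le_sub hC hTC hp ha hb hε ‖x₀ - p‖
  filter_upwards [hdiff.eventually_lt_const hη] with n hn
  rw [mem_ball_zero_iff, norm_norm]
  by_contra! hle
  have := h _ (hα n) _ (hβ n) _ (kIterate_mem hC hTC (fun n => hsub (hα n))
    (fun n => hsub (hβ n)) hx₀ n) (hanti (Nat.zero_le n)) hle
  have e : kIterate T α β x₀ (n + 1) = kStep T (α n) (β n) (kIterate T α β x₀ n) := rfl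
  simp only [Function.comp_apply, e] at hn
  linarith

end KIteration

theorem mainTheorem6 {X : Type*} [NormedAddCommGroup X] [NormedSpace ℝ X] [CompleteSpace X]
    [UniformConvexSpace X] (hX : OpialProperty X)
    (C : Set X) (hCclosed : IsClosed C) (hCconvex : Convex ℝ C)
    (T : X → X) (hTC : Set.MapsTo T C C) (hT : ConditionC C T)
    (hF : (fixedPointsOn C T).Nonempty)
    (a b : ℝ) (ha : 0 < a) (hab : a ≤ b) (hb : b < 1)
    (α β : ℕ → ℝ) (hα : ∀ n, α n ∈ Set.Icc a b) (hβ : ∀ n, β n ∈ Set.Icc a b)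
    (x₀ : X) (hx₀ : x₀ ∈ C) :
    ∃ p ∈ fixedPointsOn C T, WeaklyConvergesTo (kIterate T α β x₀) p := by
  have hsub : Icc a b ⊆ Icc 0 1 := Icc_subset_Icc ha.le hb.le
  have hα' (n : ℕ) := hsub (hα n)
  have hβ' (n : ℕ) := hsub (hβ n)
  have hmem := kIterate_mem hCconvex hTC hα' hβ' hx₀
  have hreg := hT.tendsto_norm_kIterate_sub_map hCconvex hTC hF ha hb hα hβ hx₀
  have hlim {p : X} (hp : p ∈ fixedPointsOn C T) :
      ∃ c, Tendsto (fun n => ‖kIterate T α β x₀ n - p‖) atTop (𝓝 c) :=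
    (hT.antitone_norm_kIterate_sub hCconvex hTC hp hα' hβ' hx₀).exists_tendsto_of_nonneg
      fun n => norm_nonneg _
  obtain ⟨R, hR⟩ : ∃ R, ∀ n, ‖kIterate T α β x₀ n‖ ≤ R := by
    obtain ⟨p, hp⟩ := hF
    refine ⟨‖x₀ - p‖ + ‖p‖, fun n => ?_⟩
    have h1 : ‖kIterate T α β x₀ n - p‖ ≤ ‖x₀ - p‖ :=
      hT.antitone_norm_kIterate_sub hCconvex hTC hp hα' hβ' hx₀ (Nat.zero_le n)
    have h2 := norm_add_le (kIterate T α β x₀ n - p) p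
    rw [sub_add_cancel] at h2
    linarith
  have hsubseq {φ : ℕ → ℕ} (hφ : Tendsto φ atTop atTop) : ∃ p ∈ fixedPointsOn C T,
      ∃ ψ : ℕ → ℕ, StrictMono ψ ∧ WeaklyConvergesTo (kIterate T α β x₀ ∘ φ ∘ ψ) p := by
    obtain ⟨p, ψ, hψ, hp⟩ := exists_weaklyConvergesTo_subseq
      (u := kIterate T α β x₀ ∘ φ) fun n => hR _
    have hpC := hp.mem_of_isClosed_convex hCclosed hCconvex fun n => hmem _
    exact ⟨p, ⟨hpC, hT.map_eq_of_weaklyConvergesTo hX hTC (fun n => hmem _) hpC hp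
      (fun n => hR _) (hreg.comp (hφ.comp hψ.tendsto_atTop))⟩, ψ, hψ, hp⟩
  obtain ⟨p, hpF, ψ, hψ, hp⟩ := hsubseq tendsto_id
  -- It suffices that every subsequence has a further one converging weakly to `p`.
  refine ⟨p, hpF, tendsto_of_subseq_tendsto fun φ hφ => ?_⟩
  obtain ⟨q, hqF, χ, hχ, hq⟩ := hsubseq hφ
  obtain ⟨c, hc⟩ := hlim hpF
  obtain ⟨d, hd⟩ := hlim hqF
  obtain rfl : p = q := hX.eq_of_tendsto_norm_sub hc hd (tendsto_id.comp hψ.tendsto_atTop)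
    (hφ.comp hχ.tendsto_atTop) hp hq
  exact ⟨χ, hq⟩
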